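/- Theorem. Let $\alpha\in(0,1)$ be irrational, with regular continued fraction expansion $$\alpha=\cfrac{1}{a_1+\cfrac{1}{a_2+\cfrac{1}{a_3+\cdots}}},$$ and define the convergents $(p_n/q_n)_{n\ge1}$ by $p_1=0$, $p_2=1$, $q_1=1$, $q_2=a_1$ and $p_{n+1}=a_np_n+p_{n-1}$, $q_{n+1}=a_nq_n+q_{n-1}$ for $n\ge2$. Put $\alpha_n=|q_n\alpha-p_n|$ for $n\ge 1$, let $Z_\alpha=\prod_{n=1}^\infty\{0,1,\dots,a_n\}$, and let $$\mathcal V_\alpha=\Bigl\{x\in(0,1)\ \Bigm|\ \text{there is exactly one }(x_1,x_2,\dots)\in Z_\alpha\text{ with }x=\sum_{n=1}^\infty x_n\alpha_n\Bigr\}.$$ Assume that $a_n=1$ for only finitely many $n\ge1$, and let $n_0=\sup\{n\ge1: a_n=1\}$, with $n_0=0$ if there is no such $n$. Then the Hausdorff dimension of $\mathcal V_\alpha$ is positive if and only if $$\liminf_{n\to\infty}\frac{\sum_{k=n_0+1}^n\log(a_k-1)}{\log q_{n+1}}>0.$$ -/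

import Mathlib

noncomputable section

namespace RotationalExpansion

/-- The partial quotient `a_n` (`n ≥ 1`) of the regular continued fraction
`α = 1 / (a_1 + 1 / (a_2 + ⋯))` of an irrational `α ∈ (0,1)`.
Mathlib lists the partial denominators from index `0`. -/
def partialQuotient (α : ℝ) (n : ℕ) : ℕ :=
  ⌊((GenContFract.of α).partDens.get? (n - 1)).getD 0⌋₊

/-- The numerator `p_n` (`n ≥ 1`) of the `n`-th convergent, numbered so that
`p_1 = 0`, `p_2 = 1` and `p_{n+1} = a_n p_n + p_{n-1}`. -/
def convNum (α : ℝ) (n : ℕ) : ℝ :=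
  (GenContFract.of α).nums (n - 1)

/-- The denominator `q_n` (`n ≥ 1`) of the `n`-th convergent, numbered so that
`q_1 = 1`, `q_2 = a_1` and `q_{n+1} = a_n q_n + q_{n-1}`. -/
def convDen (α : ℝ) (n : ℕ) : ℝ :=
  (GenContFract.of α).dens (n - 1)

/-- `α_n = |q_n α - p_n|` for `n ≥ 1`. -/
def rotBase (α : ℝ) (n : ℕ) : ℝ :=
  |convDen α n * α - convNum α n|

/-- The digit space `Z_α = ∏_{n ≥ 1} {0, 1, …, a_n}`. The digit `x_n` is `d (n - 1)`. -/
def digitSpace (α : ℝ) : Set (ℕ → ℕ) :=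
  {d | ∀ k, d k ≤ partialQuotient α (k + 1)}

/-- `d` is a rotational expansion of `x`, that is `x = ∑_{n ≥ 1} x_n α_n`
with `x_n = d (n - 1)`. -/
def IsExpansion (α : ℝ) (d : ℕ → ℕ) (x : ℝ) : Prop :=
  HasSum (fun k : ℕ => (d k : ℝ) * rotBase α (k + 1)) x

/-- The set `V_α` of the `x ∈ (0,1)` with exactly one expansion with digits in `Z_α`. -/
def uniqueSet (α : ℝ) : Set ℝ :=
  {x | x ∈ Set.Ioo (0 : ℝ) 1 ∧ ∃! d : ℕ → ℕ, d ∈ digitSpace α ∧ IsExpansion α d x}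

/-- The indices `n ≥ 1` with `a_n = 1`. -/
def onesIndices (α : ℝ) : Set ℕ :=
  {n | 1 ≤ n ∧ partialQuotient α n = 1}

/-- `n_0 = sup {n ≥ 1 : a_n = 1}` (the supremum of the empty set of natural numbers is `0`). -/
def lastOne (α : ℝ) : ℕ :=
  sSup (onesIndices α)

end RotationalExpansion

end

/-! Write `β k` for `gaussProd α k`. Then `β 0 = 1`, `β k = α_k` for `k ≥ 1`, and `β k = A k * β
(k+1) + β (k+2)` with `A k = a_{k+1}`. Telescoping shows that the largest sum carried by the digits
from index `k` on is `β k + β (k+1)`, and every smaller nonnegative remainder is attained greedily.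
Hence a digit can be lowered or raised exactly when the remainder after it is small or large enough.
Uniqueness therefore propagates `0 < d k` and `d k < A k` to the next index, so a unique expansion
eventually has `A k - 1` choices per digit (`eventually_digit_of_unique`). Conversely, digits that
vanish up to `n_0` and lie strictly between `0` and `A k` afterwards give a unique expansion
(`unique_of_digit`). The dimension then depends on how `∏ (a_k - 1)` compares with powers of `β n`.
Cylinders of size comparable to `β n` give the upper bound (`dimH_le_of_frequently_card_le`).
Sending such digits to the mixed radix expansion with the same digits is Hölder onto `[0,1]`, which
gives positive dimension (`dimH_digits_pos`). Finally `1/2 ≤ q_{n+1} * β n ≤ 1` turns powers of `β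
n` into powers of `q_{n+1}`. -/

open Filter Topology Finset

namespace RotationalExpansion

/-! ### Continued fractions and the Euclidean recurrence -/

/-- The complete quotients of the continued fraction expansion of `α`. -/
noncomputable def completeQuotient (α : ℝ) : ℕ → ℝ
  | 0 => α
  | n + 1 => (Int.fract (completeQuotient α n))⁻¹

/-- The product of the first `n` iterates of the Gauss map at `α`. -/
noncomputable def gaussProd (α : ℝ) (n : ℕ) : ℝ :=
  ∏ i ∈ range n, Int.fract (completeQuotient α i)

theorem irrational_fract {x : ℝ} (h : Irrational x) : Irrational (Int.fract x) := by
  rw [Int.fract]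
  exact h.sub_intCast _

theorem irrational_completeQuotient {α : ℝ} (h : Irrational α) (n : ℕ) :
    Irrational (completeQuotient α n) := by
  induction n with
  | zero => exact h
  | succ n ih => exact (irrational_fract ih).inv

theorem fract_completeQuotient_pos {α : ℝ} (h : Irrational α) (n : ℕ) :
    0 < Int.fract (completeQuotient α n) :=
  lt_of_le_of_ne (Int.fract_nonneg _) (irrational_fract (irrational_completeQuotient h n)).ne_zero.symm

/-- Irrationality keeps every fractional part nonzero, so the algorithm never stops and the default
values in `partialQuotient` are never used. -/
theorem stream_eq {α : ℝ} (h : Irrational α) (n : ℕ) :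
    GenContFract.IntFractPair.stream α n =
      some (GenContFract.IntFractPair.of (completeQuotient α n)) := by
  induction n with
  | zero => rfl
  | succ n ih =>
    exact GenContFract.IntFractPair.stream_succ_of_some ih (fract_completeQuotient_pos h n).ne'

theorem one_lt_completeQuotient_succ {α : ℝ} (h : Irrational α) (n : ℕ) :
    1 < completeQuotient α (n + 1) :=
  (one_lt_inv₀ (fract_completeQuotient_pos h n)).2 (Int.fract_lt_one _)

theorem partialQuotient_succ {α : ℝ} (h : Irrational α) (n : ℕ) :
    (partialQuotient α (n + 1) : ℝ) = ⌊completeQuotient α (n + 1)⌋ := by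
  have h1 := GenContFract.get?_of_eq_some_of_succ_get?_intFractPair_stream (stream_eq h (n + 1))
  have h2 := GenContFract.partDen_eq_s_b h1
  have h3 : (0 : ℤ) ≤ ⌊completeQuotient α (n + 1)⌋ :=
    Int.floor_nonneg.2 (zero_le_one.trans (one_lt_completeQuotient_succ h n).le)
  rw [partialQuotient, Nat.add_sub_cancel, h2]
  simp only [Option.getD_some, GenContFract.IntFractPair.of]
  rw [natCast_floor_eq_intCast_floor (by exact_mod_cast h3), Int.floor_intCast]

theorem get?_of_eq {α : ℝ} (h : Irrational α) (n : ℕ) :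
    (GenContFract.of α).s.get? n = some ⟨1, (partialQuotient α (n + 1) : ℝ)⟩ := by
  rw [partialQuotient_succ h]
  exact GenContFract.get?_of_eq_some_of_succ_get?_intFractPair_stream (stream_eq h (n + 1))

theorem one_le_partialQuotient {α : ℝ} (h : Irrational α) (n : ℕ) :
    1 ≤ partialQuotient α (n + 1) := by
  have : (1 : ℤ) ≤ ⌊completeQuotient α (n + 1)⌋ :=
    Int.le_floor.2 (by exact_mod_cast (one_lt_completeQuotient_succ h n).le)
  have h2 : (1 : ℝ) ≤ (partialQuotient α (n + 1) : ℝ) := by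
    rw [partialQuotient_succ h]; exact_mod_cast this
  exact_mod_cast h2

/-- `β k = A k * β (k + 1) + β (k + 2)`, with positive terms: the Euclidean algorithm. -/
structure IsEuclidean (A : ℕ → ℕ) (β : ℕ → ℝ) : Prop where
  one_le : ∀ k, 1 ≤ A k
  pos : ∀ k, 0 < β k
  eq : ∀ k, β k = A k * β (k + 1) + β (k + 2)

theorem isEuclidean_gaussProd {α : ℝ} (h : Irrational α) :
    IsEuclidean (fun k => partialQuotient α (k + 1)) (gaussProd α) where
  one_le := one_le_partialQuotient h
  pos k := prod_pos fun i _ => fract_completeQuotient_pos h i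
  eq k := by
    have h1 := fract_completeQuotient_pos h k
    have h2 : (partialQuotient α (k + 1) : ℝ) + Int.fract (completeQuotient α (k + 1)) =
        (Int.fract (completeQuotient α k))⁻¹ := by
      rw [partialQuotient_succ h, Int.floor_add_fract, completeQuotient]
    simp only [gaussProd, prod_range_succ]
    calc _ = (∏ i ∈ range k, Int.fract (completeQuotient α i)) *
          (Int.fract (completeQuotient α k) * (Int.fract (completeQuotient α k))⁻¹) := by
          rw [mul_inv_cancel₀ h1.ne', mul_one]
      _ = _ := by rw [← h2]; ring

theorem gaussProd_zero (α : ℝ) : gaussProd α 0 = 1 := by simp [gaussProd]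

theorem gaussProd_one {α : ℝ} (hα : α ∈ Set.Ioo (0 : ℝ) 1) : gaussProd α 1 = α := by
  simp [gaussProd, completeQuotient, Int.fract_eq_self.2 ⟨hα.1.le, hα.2⟩]

theorem convDen_one (α : ℝ) : convDen α 1 = 1 := by simp [convDen]

theorem convDen_two {α : ℝ} (h : Irrational α) : convDen α 2 = partialQuotient α 1 := by
  simp [convDen, GenContFract.first_den_eq (get?_of_eq h 0)]

theorem convDen_add_three {α : ℝ} (h : Irrational α) (n : ℕ) :
    convDen α (n + 3) = partialQuotient α (n + 2) * convDen α (n + 2) + convDen α (n + 1) := by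
  have := GenContFract.dens_recurrence (get?_of_eq h (n + 1)) rfl rfl
  simpa [convDen] using this

theorem convNum_add_three {α : ℝ} (h : Irrational α) (n : ℕ) :
    convNum α (n + 3) = partialQuotient α (n + 2) * convNum α (n + 2) + convNum α (n + 1) := by
  have := GenContFract.nums_recurrence (get?_of_eq h (n + 1)) rfl rfl
  simpa [convNum] using this

theorem convDen_mul_sub_convNum {α : ℝ} (h : Irrational α) (hα : α ∈ Set.Ioo (0 : ℝ) 1) (n : ℕ) :
    convDen α (n + 1) * α - convNum α (n + 1) = (-1) ^ n * gaussProd α (n + 1) := by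
  have hfl : (⌊α⌋ : ℝ) = 0 := by exact_mod_cast Int.floor_eq_zero_iff.2 ⟨hα.1.le, hα.2⟩
  induction n using Nat.twoStepInduction with
  | zero => simp [convDen, convNum, gaussProd_one hα, hfl]
  | one =>
    have h0 := (isEuclidean_gaussProd h).eq 0
    have h1 : convNum α 2 = 1 := by
      simp [convNum, GenContFract.first_num_eq (get?_of_eq h 0), hfl]
    simp only [zero_add, gaussProd_zero, gaussProd_one hα] at h0
    norm_num
    rw [convDen_two h, h1]
    linarith
  | more n ih1 ih2 =>
    have h0 := (isEuclidean_gaussProd h).eq (n + 1)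
    rw [convDen_add_three h, convNum_add_three h]
    simp only [show n + 1 + 1 = n + 2 by ring, show n + 1 + 2 = n + 3 by ring] at *
    rw [pow_add] at *
    norm_num at *
    linear_combination ih1 + partialQuotient α (n + 2) * ih2 + (-1) ^ n * h0

theorem rotBase_succ {α : ℝ} (h : Irrational α) (hα : α ∈ Set.Ioo (0 : ℝ) 1) (n : ℕ) :
    rotBase α (n + 1) = gaussProd α (n + 1) := by
  rw [rotBase, convDen_mul_sub_convNum h hα, abs_mul, abs_pow, abs_neg, abs_one, one_pow, one_mul,
    abs_of_pos ((isEuclidean_gaussProd h).pos _)]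

theorem convDen_pos {α : ℝ} (h : Irrational α) (n : ℕ) : 0 < convDen α (n + 1) := by
  induction n using Nat.twoStepInduction with
  | zero => simp [convDen_one]
  | one => rw [convDen_two h]; exact_mod_cast one_le_partialQuotient h 0
  | more n ih1 ih2 => rw [convDen_add_three h]; positivity

theorem convDen_le_succ {α : ℝ} (h : Irrational α) (n : ℕ) :
    convDen α (n + 1) ≤ convDen α (n + 2) := by
  cases n with
  | zero => rw [convDen_one, convDen_two h]; exact_mod_cast one_le_partialQuotient h 0
  | succ n =>
    rw [convDen_add_three h]
    have h1 : (1 : ℝ) ≤ partialQuotient α (n + 2) := by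
      exact_mod_cast one_le_partialQuotient h (n + 1)
    nlinarith [convDen_pos h n, convDen_pos h (n + 1)]

/-- The recurrences for `q` and `β` run in opposite directions, so this bilinear expression is
invariant. It is the source of the comparison of `β n` with `1 / q_{n+1}`. -/
theorem convDen_mul_gaussProd {α : ℝ} (h : Irrational α) (n : ℕ) :
    convDen α (n + 2) * gaussProd α (n + 1) + convDen α (n + 1) * gaussProd α (n + 2) = 1 := by
  induction n with
  | zero =>
    have h0 := (isEuclidean_gaussProd h).eq 0
    rw [gaussProd_zero] at h0
    rw [convDen_two h, convDen_one]
    linarith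
  | succ n ih =>
    rw [convDen_add_three h]
    have h0 := (isEuclidean_gaussProd h).eq (n + 1)
    simp only [show n + 1 + 1 = n + 2 by ring, show n + 1 + 2 = n + 3 by ring] at *
    rw [h0] at ih
    linarith

namespace IsEuclidean

variable {A : ℕ → ℕ} {β : ℕ → ℝ}

theorem succ_add_le (H : IsEuclidean A β) (k : ℕ) : β (k + 1) + β (k + 2) ≤ β k := by
  have h1 : (1 : ℝ) ≤ A k := by exact_mod_cast H.one_le k
  nlinarith [H.eq k, H.pos (k + 1)]

theorem succ_lt (H : IsEuclidean A β) (k : ℕ) : β (k + 1) < β k := by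
  linarith [H.succ_add_le k, H.pos (k + 2)]

theorem strictAnti (H : IsEuclidean A β) : StrictAnti β := strictAnti_nat_of_succ_lt H.succ_lt

theorem le_geometric (H : IsEuclidean A β) (k : ℕ) : β (2 * k) ≤ β 0 * (1 / 2) ^ k := by
  induction k with
  | zero => simp
  | succ k ih =>
    have h1 := H.succ_add_le (2 * k)
    have h2 := H.succ_lt (2 * k + 1)
    rw [pow_succ, show 2 * (k + 1) = 2 * k + 2 by ring]
    linarith

theorem tendsto_zero (H : IsEuclidean A β) : Tendsto β atTop (𝓝 0) := by
  have h1 : Tendsto (fun n : ℕ => β 0 * (1 / 2 : ℝ) ^ (n / 2)) atTop (𝓝 0) := by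
    have := (tendsto_pow_atTop_nhds_zero_of_lt_one (r := (1 / 2 : ℝ)) (by norm_num)
      (by norm_num)).const_mul (β 0)
    rw [mul_zero] at this
    exact this.comp (Nat.tendsto_div_const_atTop (by norm_num))
  refine squeeze_zero (fun n => (H.pos n).le) (fun n => ?_) h1
  exact (H.strictAnti.antitone (Nat.mul_div_le n 2)).trans (H.le_geometric _)

end IsEuclidean

theorem convDen_mul_gaussProd_le {α : ℝ} (h : Irrational α) (n : ℕ) :
    convDen α (n + 1) * gaussProd α n ≤ 1 := by
  have H := isEuclidean_gaussProd h
  cases n with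
  | zero => simp [convDen_one, gaussProd_zero]
  | succ n => nlinarith [convDen_mul_gaussProd h n, convDen_pos h n, H.pos (n + 2)]

theorem one_le_two_mul_convDen_mul_gaussProd {α : ℝ} (h : Irrational α) (n : ℕ) :
    1 ≤ 2 * (convDen α (n + 1) * gaussProd α n) := by
  have H := isEuclidean_gaussProd h
  cases n with
  | zero => norm_num [convDen_one, gaussProd_zero]
  | succ n =>
    have h1 := convDen_mul_gaussProd h n
    -- Of the two summands in the identity, the first is the larger, hence at least `1/2`.
    have h2 := mul_le_mul (convDen_le_succ h n) (H.succ_lt (n + 1)).le (H.pos _).le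
      (convDen_pos h (n + 1)).le
    simp only [show n + 1 + 1 = n + 2 by ring] at *
    linarith

end RotationalExpansion

/-! ### Greedy expansions and telescoping tail bounds -/

/-- Every point is reached by a greedy choice of digits, provided each step can be done. -/
theorem exists_hasSum_of_step {w T : ℕ → ℝ} (hw : ∀ k, 0 ≤ w k)
    (hT : Tendsto T atTop (𝓝 0)) {P : ℕ → ℕ → Prop}
    (hstep : ∀ k, ∀ r ∈ Set.Icc 0 (T k), ∃ j, P k j ∧ r - j * w k ∈ Set.Icc 0 (T (k + 1)))
    {x : ℝ} (hx : x ∈ Set.Icc 0 (T 0)) :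
    ∃ d : ℕ → ℕ, (∀ k, P k (d k)) ∧ HasSum (fun k => (d k : ℝ) * w k) x := by
  choose! f hf using hstep
  let r : ℕ → ℝ := fun n => Nat.rec x (fun k r => r - f k r * w k) n
  have hr : ∀ n, r n ∈ Set.Icc 0 (T n) := by
    intro n
    induction n with
    | zero => exact hx
    | succ n ih => exact (hf n _ ih).2
  have hsum : ∀ n, ∑ k ∈ range n, (f k (r k) : ℝ) * w k = x - r n := by
    intro n
    induction n with
    | zero => simp [r]
    | succ n ih =>
      rw [sum_range_succ, ih]
      change _ = x - (r n - f n (r n) * w n)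
      ring
  refine ⟨fun k => f k (r k), fun k => (hf k _ (hr k)).1, ?_⟩
  rw [hasSum_iff_tendsto_nat_of_nonneg (fun k => mul_nonneg (Nat.cast_nonneg _) (hw k))]
  simp only [hsum]
  have : Tendsto r atTop (𝓝 0) := squeeze_zero (fun n => (hr n).1) (fun n => (hr n).2) hT
  simpa using this.const_sub x

/-- `T k` is the largest tail from index `k`, and `w k ≤ T (k + 1)` rules out gaps between
consecutive digits. The greedy digit is the smaller of `b k` and `⌊r / w k⌋₊`. -/
theorem exists_hasSum_of_le_tail {w T : ℕ → ℝ} {b : ℕ → ℕ} (hw : ∀ k, 0 < w k)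
    (hT : Tendsto T atTop (𝓝 0)) (hTb : ∀ k, T k = b k * w k + T (k + 1))
    (hwT : ∀ k, w k ≤ T (k + 1)) {x : ℝ} (hx : x ∈ Set.Icc 0 (T 0)) :
    ∃ d : ℕ → ℕ, (∀ k, d k ≤ b k) ∧ HasSum (fun k => (d k : ℝ) * w k) x := by
  refine exists_hasSum_of_step (P := fun k j => j ≤ b k) (fun k => (hw k).le) hT ?_ hx
  rintro k r ⟨h0, h1⟩
  rcases le_total (b k : ℝ) (r / w k) with h | h
  · refine ⟨b k, le_rfl, ?_, by linarith [hTb k]⟩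
    rw [le_div_iff₀ (hw k)] at h
    linarith
  · refine ⟨⌊r / w k⌋₊, Nat.floor_le_of_le h, ?_, ?_⟩
    · have := Nat.floor_le (div_nonneg h0 (hw k).le)
      rw [le_div_iff₀ (hw k)] at this
      linarith
    · have := Nat.lt_floor_add_one (r / w k)
      rw [div_lt_iff₀ (hw k)] at this
      linarith [hwT k]

theorem HasSum.tail {f : ℕ → ℝ} {x : ℝ} (h : HasSum f x) (n : ℕ) :
    HasSum (fun k => f (k + n)) (x - ∑ k ∈ range n, f k) :=
  (hasSum_nat_add_iff' n).2 h

theorem HasSum.le_of_le_sub {f T : ℕ → ℝ} {x : ℝ} (h : HasSum f x) (hT : ∀ k, 0 ≤ T k)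
    (hf : ∀ k, f k ≤ T k - T (k + 1)) : x ≤ T 0 := by
  refine le_of_tendsto' h.tendsto_sum_nat fun n => ?_
  calc ∑ k ∈ range n, f k ≤ ∑ k ∈ range n, (T k - T (k + 1)) := sum_le_sum fun k _ => hf k
    _ = T 0 - T n := sum_range_sub' T n
    _ ≤ T 0 := by linarith [hT n]

theorem HasSum.tail_le_of_le_sub {f T : ℕ → ℝ} {x : ℝ} (h : HasSum f x) (hT : ∀ k, 0 ≤ T k)
    (hf : ∀ k, f k ≤ T k - T (k + 1)) (n : ℕ) : x - ∑ k ∈ range n, f k ≤ T n := by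
  have := (h.tail n).le_of_le_sub (T := fun k => T (k + n)) (fun k => hT _) (fun k => ?_)
  · simpa using this
  · have := hf (k + n)
    rwa [add_right_comm] at this

theorem HasSum.tail_nonneg {f : ℕ → ℝ} {x : ℝ} (h : HasSum f x) (hf : ∀ k, 0 ≤ f k) (n : ℕ) :
    0 ≤ x - ∑ k ∈ range n, f k :=
  (h.tail n).nonneg fun _ => hf _

/-! ### Upper bound for the dimension by cylinders -/

-- Points sharing their first `n` digits differ by at most `T n`. Counting these cylinders bounds
-- the `s`-dimensional measure; a bound along infinitely many `n` is enough, since only a liminf of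
-- covering sums enters.
open MeasureTheory Metric ENNReal in
theorem dimH_le_of_frequently_card_le {w T : ℕ → ℝ} {D : ℕ → Finset ℕ} (hw : ∀ k, 0 ≤ w k)
    (hT : ∀ k, 0 < T k) (hT0 : Tendsto T atTop (𝓝 0))
    (hD : ∀ k, ∀ j ∈ D k, (j : ℝ) * w k ≤ T k - T (k + 1)) {s K : ℝ} (hs : 0 ≤ s)
    (hf : ∃ᶠ n in atTop, (∏ k ∈ range n, ((D k).card : ℝ)) ≤ K * T n ^ (-s)) :
    dimH {x : ℝ | ∃ d : ℕ → ℕ, (∀ k, d k ∈ D k) ∧ HasSum (fun k => (d k : ℝ) * w k) x} ≤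
      ENNReal.ofReal s := by
  set S : Set ℝ := {x | ∃ d : ℕ → ℕ, (∀ k, d k ∈ D k) ∧ HasSum (fun k => (d k : ℝ) * w k) x}
  let t : ∀ n : ℕ, ((k : Fin n) → D k) → Set ℝ := fun n p =>
    {x | ∃ d : ℕ → ℕ, (∀ k, d k ∈ D k) ∧ HasSum (fun k => (d k : ℝ) * w k) x ∧
      ∀ k : Fin n, d k = p k}
  have hdiam : ∀ n p, ediam (t n p) ≤ ENNReal.ofReal (T n) := by
    intro n p
    refine ediam_le ?_
    rintro x ⟨d, hd, hdx, hdp⟩ y ⟨e, he, hey, hep⟩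
    rw [edist_dist, Real.dist_eq]
    refine ENNReal.ofReal_le_ofReal ?_
    have heq : ∑ k ∈ range n, (d k : ℝ) * w k = ∑ k ∈ range n, (e k : ℝ) * w k := by
      refine sum_congr rfl fun k hk => ?_
      have h1 := hdp ⟨k, mem_range.1 hk⟩
      have h2 := hep ⟨k, mem_range.1 hk⟩
      simp only at h1 h2
      rw [h1, h2]
    have h1 := hdx.tail_le_of_le_sub (fun k => (hT k).le) (fun k => hD k _ (hd k)) n
    have h2 := hey.tail_le_of_le_sub (fun k => (hT k).le) (fun k => hD k _ (he k)) n
    have h3 := hdx.tail_nonneg (fun k => mul_nonneg (Nat.cast_nonneg _) (hw k)) n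
    have h4 := hey.tail_nonneg (fun k => mul_nonneg (Nat.cast_nonneg _) (hw k)) n
    rw [abs_le]
    constructor <;> linarith
  have hcov : ∀ n, S ⊆ ⋃ p, t n p := by
    rintro n x ⟨d, hd, hdx⟩
    exact Set.mem_iUnion.2 ⟨fun k => ⟨d k, hd k⟩, d, hd, hdx, fun k => rfl⟩
  have hr : Tendsto (fun n => ENNReal.ofReal (T n)) atTop (𝓝 0) := by
    simpa using ENNReal.tendsto_ofReal hT0
  have hμ : μH[s] S ≤ ENNReal.ofReal K := by
    refine (Measure.hausdorffMeasure_le_liminf_sum s S _ hr t (.of_forall hdiam) (.of_forall hcov)).trans ?_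
    refine liminf_le_of_frequently_le' (hf.mono fun n hn => ?_)
    calc ∑ p, ediam (t n p) ^ s
        ≤ ∑ p : ((k : Fin n) → D k), ENNReal.ofReal (T n) ^ s :=
          sum_le_sum fun p _ => ENNReal.rpow_le_rpow (hdiam n p) hs
      _ = ENNReal.ofReal ((∏ k ∈ range n, ((D k).card : ℝ)) * T n ^ s) := by
          rw [sum_const, card_univ, Fintype.card_pi, nsmul_eq_mul,
            ENNReal.ofReal_mul (prod_nonneg fun _ _ => Nat.cast_nonneg _),
            ENNReal.ofReal_rpow_of_pos (hT n)]
          congr 1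
          rw [← Nat.cast_prod, ENNReal.ofReal_natCast, ← Fin.prod_univ_eq_prod_range]
          simp
      _ ≤ ENNReal.ofReal K := by
          refine ENNReal.ofReal_le_ofReal ?_
          have h1 := mul_le_mul_of_nonneg_right hn (Real.rpow_nonneg (hT n).le s)
          rwa [mul_assoc, ← Real.rpow_add (hT n), neg_add_cancel, Real.rpow_zero, mul_one] at h1
  have := dimH_le_of_hausdorffMeasure_ne_top (s := S) (d := s.toNNReal)
    (by rw [Real.coe_toNNReal s hs]; exact ne_top_of_le_ne_top ENNReal.ofReal_ne_top hμ)
  exact this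

/-! ### Lower bound for the dimension by mixed radix expansions -/

open scoped NNReal in
/-- A set that carries an inverse Hölder parametrization by `[0, 1]` has positive dimension. -/
theorem dimH_image_pos_of_abs_sub_le {g : ℝ → ℝ} {C s : ℝ} (hs : 0 < s) (hC : 0 ≤ C)
    (hg : ∀ x ∈ Set.Icc (0 : ℝ) 1, ∀ y ∈ Set.Icc (0 : ℝ) 1, |x - y| ≤ C * |g x - g y| ^ s) :
    0 < dimH (g '' Set.Icc 0 1) := by
  have hinj : Set.InjOn g (Set.Icc 0 1) := by
    intro x hx y hy hxy
    have := hg x hx y hy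
    rw [hxy, sub_self, abs_zero, Real.zero_rpow hs.ne', mul_zero] at this
    exact sub_eq_zero.1 (abs_nonpos_iff.1 this)
  have hinv := hinj.leftInvOn_invFunOn
  have hH : HolderOnWith C.toNNReal s.toNNReal (Function.invFunOn g (Set.Icc 0 1))
      (g '' Set.Icc 0 1) := by
    rintro _ ⟨x, hx, rfl⟩ _ ⟨y, hy, rfl⟩
    rw [hinv hx, hinv hy, edist_dist, edist_dist, Real.coe_toNNReal s hs.le, Real.dist_eq,
      Real.dist_eq, ENNReal.ofReal_rpow_of_nonneg (abs_nonneg _) hs.le]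
    change _ ≤ ENNReal.ofReal C * _
    rw [← ENNReal.ofReal_mul hC]
    exact ENNReal.ofReal_le_ofReal (hg x hx y hy)
  -- The Hölder inverse maps onto `[0,1]`, so `1 ≤ dimH (g '' [0,1]) / s`.
  have h1 := hH.dimH_image_le (by simpa using hs)
  rw [hinv.image_image, Real.dimH_of_nonempty_interior (by simp [interior_Icc])] at h1
  by_contra h0
  rw [not_lt, nonpos_iff_eq_zero] at h0
  rw [h0, ENNReal.zero_div] at h1
  simp at h1

/-- Sums of digits against `β` are separated as the integers given by the mixed radix
expansions of the digits. -/
theorem exists_radix_index {β : ℕ → ℝ} {m : ℕ → ℕ} (hm : ∀ k, 1 ≤ m k)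
    (hmβ : ∀ k, m k * β (k + 1) ≤ β k) {δ : ℕ → ℤ} (hδ : ∀ k, |δ k| < m k) (n : ℕ) :
    ∃ I : ℤ, (∑ k ∈ range n, (δ k : ℝ) * (∏ i ∈ range (k + 1), (m i : ℝ))⁻¹ =
        I * (∏ i ∈ range n, (m i : ℝ))⁻¹) ∧
      (0 ≤ I → I * β n ≤ ∑ k ∈ range n, (δ k : ℝ) * β (k + 1)) ∧
      (I ≤ 0 → ∑ k ∈ range n, (δ k : ℝ) * β (k + 1) ≤ I * β n) := by
  induction n with
  | zero => exact ⟨0, by simp, by simp, by simp⟩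
  | succ n ih =>
    obtain ⟨I, h1, h2, h3⟩ := ih
    have hmn : (0 : ℝ) < m n := by exact_mod_cast hm n
    have hd := abs_lt.1 (hδ n)
    -- Horner step. As `|δ n| < m n`, a weak sign of the new index forces the same weak sign of `I`;
    -- then `m n * β (n + 1) ≤ β n` preserves the estimate.
    refine ⟨m n * I + δ n, ?_, fun h => ?_, fun h => ?_⟩
    · rw [sum_range_succ, h1, prod_range_succ]
      push_cast
      field_simp
    · have hI : 0 ≤ I := by
        by_contra hI
        nlinarith
      have hI' : (0 : ℝ) ≤ I := by exact_mod_cast hI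
      rw [sum_range_succ]
      push_cast
      nlinarith [h2 hI, mul_le_mul_of_nonneg_left (hmβ n) hI']
    · have hI : I ≤ 0 := by
        by_contra hI
        nlinarith
      have hI' : (I : ℝ) ≤ 0 := by exact_mod_cast hI
      rw [sum_range_succ]
      push_cast
      nlinarith [h3 hI, mul_le_mul_of_nonpos_left (hmβ n) hI']

/-- Both differences are compared with the integer index `I` of the truncated digit differences.
Dropping the tails costs one unit at scale `β n` and one at scale `(∏ m i)⁻¹`, whence the `2`. -/
theorem abs_radix_sub_le {β : ℕ → ℝ} {m : ℕ → ℕ} (hβ : ∀ k, 0 < β k) (hm : ∀ k, 1 ≤ m k)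
    (hmβ : ∀ k, m k * β (k + 1) ≤ β k) {d e : ℕ → ℕ} (hd : ∀ k, d k < m k) (he : ∀ k, e k < m k)
    {x y u v : ℝ} (hx : HasSum (fun k => (d k : ℝ) * β (k + 1)) x)
    (hy : HasSum (fun k => (e k : ℝ) * β (k + 1)) y)
    (hu : HasSum (fun k => (d k : ℝ) * (∏ i ∈ range (k + 1), (m i : ℝ))⁻¹) u)
    (hv : HasSum (fun k => (e k : ℝ) * (∏ i ∈ range (k + 1), (m i : ℝ))⁻¹) v) (n : ℕ) :
    |u - v| ≤ (|x - y| / β n + 2) * (∏ i ∈ range n, (m i : ℝ))⁻¹ := by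
  have hMpos : ∀ n, 0 < ∏ i ∈ range n, (m i : ℝ) := fun n =>
    prod_pos fun i _ => by exact_mod_cast hm i
  have tail1 : ∀ (d : ℕ → ℕ) (x : ℝ), (∀ k, d k < m k) →
      HasSum (fun k => (d k : ℝ) * β (k + 1)) x →
      0 ≤ x - ∑ k ∈ range n, (d k : ℝ) * β (k + 1) ∧
        x - ∑ k ∈ range n, (d k : ℝ) * β (k + 1) ≤ β n := by
    intro d x hd hx
    refine ⟨hx.tail_nonneg (fun k => mul_nonneg (Nat.cast_nonneg _) (hβ _).le) n,
      hx.tail_le_of_le_sub (fun k => (hβ k).le) (fun k => ?_) n⟩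
    have : (d k : ℝ) + 1 ≤ m k := by exact_mod_cast hd k
    nlinarith [hmβ k, hβ (k + 1)]
  have tail2 : ∀ (d : ℕ → ℕ) (x : ℝ), (∀ k, d k < m k) →
      HasSum (fun k => (d k : ℝ) * (∏ i ∈ range (k + 1), (m i : ℝ))⁻¹) x →
      0 ≤ x - ∑ k ∈ range n, (d k : ℝ) * (∏ i ∈ range (k + 1), (m i : ℝ))⁻¹ ∧
        x - ∑ k ∈ range n, (d k : ℝ) * (∏ i ∈ range (k + 1), (m i : ℝ))⁻¹ ≤
          (∏ i ∈ range n, (m i : ℝ))⁻¹ := by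
    intro d x hd hx
    refine ⟨hx.tail_nonneg (fun k => mul_nonneg (Nat.cast_nonneg _) (inv_pos.2 (hMpos _)).le) n,
      hx.tail_le_of_le_sub (T := fun n => (∏ i ∈ range n, (m i : ℝ))⁻¹)
        (fun k => (inv_pos.2 (hMpos k)).le) (fun k => ?_) n⟩
    have h1 : (d k : ℝ) + 1 ≤ m k := by exact_mod_cast hd k
    have h2 : (0 : ℝ) < m k := by exact_mod_cast hm k
    have h3 := inv_pos.2 (hMpos (k + 1))
    have h4 : (∏ i ∈ range k, (m i : ℝ))⁻¹ = m k * (∏ i ∈ range (k + 1), (m i : ℝ))⁻¹ := by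
      rw [prod_range_succ, mul_inv]
      field_simp
    simp only [h4]
    nlinarith
  obtain ⟨I, hI1, hI2, hI3⟩ := exists_radix_index hm hmβ
    (δ := fun k => (d k : ℤ) - e k) (fun k => by have := hd k; have := he k; rw [abs_lt]; omega) n
  simp only [Int.cast_sub, Int.cast_natCast, sub_mul, sum_sub_distrib] at hI1 hI2 hI3
  have hx1 := tail1 d x hd hx
  have hy1 := tail1 e y he hy
  have hu1 := tail2 d u hd hu
  have hv1 := tail2 e v he hv
  have hM := inv_pos.2 (hMpos n)
  set Q := (∏ i ∈ range n, (m i : ℝ))⁻¹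
  have hIx : |(I : ℝ)| ≤ |x - y| / β n + 1 := by
    have h1 : |(I : ℝ)| * β n ≤ |x - y| + β n := by
      rcases le_total 0 I with h | h
      · rw [abs_of_nonneg (by exact_mod_cast h : (0 : ℝ) ≤ I)]
        linarith [hI2 h, le_abs_self (x - y)]
      · rw [abs_of_nonpos (by exact_mod_cast h : (I : ℝ) ≤ 0)]
        linarith [hI3 h, neg_abs_le (x - y)]
    have h2 := (hβ n).ne'
    rw [← le_div_iff₀ (hβ n), add_div, div_self h2] at h1
    exact h1
  have huv : |u - v| ≤ |(I : ℝ)| * Q + Q := by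
    have h1 : |(I : ℝ) * Q| = |(I : ℝ)| * Q := by rw [abs_mul, abs_of_pos hM]
    rw [← h1, abs_le]
    constructor <;> linarith [le_abs_self ((I : ℝ) * Q), neg_abs_le ((I : ℝ) * Q)]
  nlinarith

theorem exists_abs_radix_sub_le_rpow {β : ℕ → ℝ} {m : ℕ → ℕ} (hβ : ∀ k, 0 < β k)
    (hm : ∀ k, 1 ≤ m k) (hmβ : ∀ k, m k * β (k + 1) ≤ β k) (hβ0 : Tendsto β atTop (𝓝 0))
    {K c s : ℝ} (hK : 0 < K) (hKβ : ∀ k, β k ≤ K * (m k * β (k + 1))) (hc : 0 < c) (hs : 0 < s)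
    (hs1 : s ≤ 1) (hM : ∀ n, c * β n ^ (-s) ≤ ∏ i ∈ range n, (m i : ℝ))
    {d e : ℕ → ℕ} (hd : ∀ k, d k < m k) (he : ∀ k, e k < m k)
    {x y u v : ℝ} (hx : HasSum (fun k => (d k : ℝ) * β (k + 1)) x)
    (hy : HasSum (fun k => (e k : ℝ) * β (k + 1)) y)
    (hu : HasSum (fun k => (d k : ℝ) * (∏ i ∈ range (k + 1), (m i : ℝ))⁻¹) u)
    (hv : HasSum (fun k => (e k : ℝ) * (∏ i ∈ range (k + 1), (m i : ℝ))⁻¹) v) :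
    |u - v| ≤ 3 * K / c * |x - y| ^ s := by
  have hMpos : ∀ n, 0 < ∏ i ∈ range n, (m i : ℝ) := fun n =>
    prod_pos fun i _ => by exact_mod_cast hm i
  have key := abs_radix_sub_le hβ hm hmβ hd he hx hy hu hv
  have hMinv : ∀ n, (∏ i ∈ range n, (m i : ℝ))⁻¹ ≤ c⁻¹ * β n ^ s := by
    intro n
    have h1 := inv_anti₀ (mul_pos hc (Real.rpow_pos_of_pos (hβ n) _)) (hM n)
    rwa [mul_inv, Real.rpow_neg (hβ n).le, inv_inv] at h1
  rcases eq_or_ne x y with rfl | hxy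
  · have hlim : Tendsto (fun n => 2 * (c⁻¹ * β n ^ s)) atTop (𝓝 0) := by
      have := ((hβ0.rpow_const (Or.inr hs.le)).const_mul c⁻¹).const_mul 2
      rwa [Real.zero_rpow hs.ne', mul_zero, mul_zero] at this
    have h1 : |u - v| ≤ 0 := by
      refine ge_of_tendsto' hlim fun n => (key n).trans ?_
      simp only [sub_self, abs_zero, zero_div, zero_add]
      linarith [hMinv n]
    rw [sub_self, abs_zero, Real.zero_rpow hs.ne', mul_zero]
    exact h1
  · set r := |x - y|
    have hr : 0 < r := abs_pos.2 (sub_ne_zero.2 hxy)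
    have hr0 : r ≤ β 0 := by
      have bd : ∀ (d : ℕ → ℕ) (x : ℝ), (∀ k, d k < m k) →
          HasSum (fun k => (d k : ℝ) * β (k + 1)) x → 0 ≤ x ∧ x ≤ β 0 := by
        intro d x hd hx
        refine ⟨hx.nonneg fun k => mul_nonneg (Nat.cast_nonneg _) (hβ _).le,
          hx.le_of_le_sub (fun k => (hβ k).le) (fun k => ?_)⟩
        have : (d k : ℝ) + 1 ≤ m k := by exact_mod_cast hd k
        nlinarith [hmβ k, hβ (k + 1)]
      have := bd d x hd hx
      have := bd e y he hy
      rw [abs_le]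
      constructor <;> linarith
    have hex : ∃ n, β n < r := ((hβ0.eventually (gt_mem_nhds hr))).exists
    classical
    -- The comparison is made at the scale of `r`. It is used at level `n + 1`, and `hKβ` then
    -- absorbs the jump from `β (n + 1)` to `β n`, however large `m n` is.
    obtain ⟨n, hn, hn'⟩ : ∃ n, β (n + 1) < r ∧ r ≤ β n := by
      have h1 := Nat.find_spec hex
      cases hk : Nat.find hex with
      | zero => rw [hk] at h1; linarith
      | succ n =>
        rw [hk] at h1
        exact ⟨n, h1, not_lt.1 (Nat.find_min hex (by omega))⟩
    have hmn : (0 : ℝ) < m n := by exact_mod_cast hm n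
    have hb1 := hβ (n + 1)
    have hb := hβ n
    have hMn := hMpos n
    calc |u - v| ≤ (r / β (n + 1) + 2) * (∏ i ∈ range (n + 1), (m i : ℝ))⁻¹ := key (n + 1)
      _ ≤ (3 * (r / β (n + 1))) * (∏ i ∈ range (n + 1), (m i : ℝ))⁻¹ := by
          refine mul_le_mul_of_nonneg_right ?_ (inv_pos.2 (hMpos _)).le
          have : 1 ≤ r / β (n + 1) := (one_le_div hb1).2 hn.le
          linarith
      _ = 3 * r * (m n * β (n + 1))⁻¹ * (∏ i ∈ range n, (m i : ℝ))⁻¹ := by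
          rw [prod_range_succ]
          field_simp
      _ ≤ 3 * r * (K * (β n)⁻¹) * (c⁻¹ * β n ^ s) := by
          refine mul_le_mul (mul_le_mul_of_nonneg_left ?_ (by positivity)) (hMinv n)
            (by positivity) (by positivity)
          rw [← div_eq_mul_inv, inv_le_comm₀ (by positivity) (by positivity), inv_div,
            div_le_iff₀ hK]
          linarith [hKβ n]
      _ = 3 * K / c * (r * β n ^ (s - 1)) := by
          rw [Real.rpow_sub_one hb.ne']
          field_simp
      _ ≤ 3 * K / c * (r * r ^ (s - 1)) := by
          refine mul_le_mul_of_nonneg_left (mul_le_mul_of_nonneg_left ?_ hr.le) (by positivity)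
          -- The exponent `s - 1` is nonpositive: this is where `s ≤ 1` enters.
          exact Real.rpow_le_rpow_of_nonpos hr hn' (by linarith)
      _ = 3 * K / c * r ^ s := by
          rw [Real.rpow_sub_one hr.ne']
          field_simp

theorem dimH_digits_pos {β : ℕ → ℝ} {m : ℕ → ℕ} (hβ : ∀ k, 0 < β k)
    (hm : ∀ k, 1 ≤ m k) (hmβ : ∀ k, m k * β (k + 1) ≤ β k) (hβ0 : Tendsto β atTop (𝓝 0))
    {K c s : ℝ} (hK : 0 < K) (hKβ : ∀ k, β k ≤ K * (m k * β (k + 1))) (hc : 0 < c) (hs : 0 < s)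
    (hs1 : s ≤ 1) (hM : ∀ n, c * β n ^ (-s) ≤ ∏ i ∈ range n, (m i : ℝ)) :
    0 < dimH {x : ℝ | ∃ d : ℕ → ℕ, (∀ k, d k < m k) ∧
      HasSum (fun k => (d k : ℝ) * β (k + 1)) x} := by
  have hMpos : ∀ n, 0 < ∏ i ∈ range n, (m i : ℝ) := fun n =>
    prod_pos fun i _ => by exact_mod_cast hm i
  have hT : Tendsto (fun n => (∏ i ∈ range n, (m i : ℝ))⁻¹) atTop (𝓝 0) := by
    have hlim : Tendsto (fun n => c⁻¹ * β n ^ s) atTop (𝓝 0) := by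
      have := (hβ0.rpow_const (Or.inr hs.le)).const_mul c⁻¹
      rwa [Real.zero_rpow hs.ne', mul_zero] at this
    refine squeeze_zero (fun n => (inv_pos.2 (hMpos n)).le) (fun n => ?_) hlim
    have h1 := inv_anti₀ (mul_pos hc (Real.rpow_pos_of_pos (hβ n) _)) (hM n)
    rwa [mul_inv, Real.rpow_neg (hβ n).le, inv_inv] at h1
  have hex : ∀ y ∈ Set.Icc (0 : ℝ) 1, ∃ (d : ℕ → ℕ) (x : ℝ), (∀ k, d k < m k) ∧
      HasSum (fun k => (d k : ℝ) * (∏ i ∈ range (k + 1), (m i : ℝ))⁻¹) y ∧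
      HasSum (fun k => (d k : ℝ) * β (k + 1)) x := by
    intro y hy
    obtain ⟨d, hd, hdy⟩ := exists_hasSum_of_le_tail (b := fun k => m k - 1)
      (w := fun k => (∏ i ∈ range (k + 1), (m i : ℝ))⁻¹) (fun k => inv_pos.2 (hMpos (k + 1))) hT
      (fun k => by
        have h2 : (0 : ℝ) < m k := by exact_mod_cast hm k
        rw [Nat.cast_sub (hm k), prod_range_succ, mul_inv]
        field_simp
        -- For mixed radix weights the largest tail after a digit equals the weight of that digit.
        simp) (fun k => le_rfl) (x := y) (by simpa using hy)
    have hd' : ∀ k, d k < m k := fun k => by have := hd k; have := hm k; omega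
    have hsum : Summable (fun k => (d k : ℝ) * β (k + 1)) := by
      refine summable_of_sum_range_le (c := β 0)
        (fun k => mul_nonneg (Nat.cast_nonneg _) (hβ _).le) fun n => ?_
      calc ∑ k ∈ range n, (d k : ℝ) * β (k + 1) ≤ ∑ k ∈ range n, (β k - β (k + 1)) := by
            refine sum_le_sum fun k _ => ?_
            have : (d k : ℝ) + 1 ≤ m k := by exact_mod_cast hd' k
            nlinarith [hmβ k, hβ (k + 1)]
        _ = β 0 - β n := sum_range_sub' β n
        _ ≤ β 0 := by linarith [hβ n]
    exact ⟨d, _, hd', hdy, hsum.hasSum⟩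
  choose! d g hd hdy hdg using hex
  refine (dimH_image_pos_of_abs_sub_le (g := g) hs (by positivity : 0 ≤ 3 * K / c) ?_).trans_le
    (dimH_mono ?_)
  · intro x hx y hy
    exact exists_abs_radix_sub_le_rpow hβ hm hmβ hβ0 hK hKβ hc hs hs1 hM (hd x hx) (hd y hy)
      (hdg x hx) (hdg y hy) (hdy x hx) (hdy y hy)
  · rintro _ ⟨y, hy, rfl⟩
    exact ⟨d y, hd y hy, hdg y hy⟩

/-! ### Unique expansions for a Euclidean sequence -/

namespace RotationalExpansion

namespace IsEuclidean

variable {A : ℕ → ℕ} {β : ℕ → ℝ}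

theorem mul_eq_sub (H : IsEuclidean A β) (k : ℕ) :
    (A k : ℝ) * β (k + 1) = (β k + β (k + 1)) - (β (k + 1) + β (k + 1 + 1)) := by
  have := H.eq k
  linarith

theorem mul_le_sub (H : IsEuclidean A β) {j k : ℕ} (hj : j ≤ A k) :
    (j : ℝ) * β (k + 1) ≤ (β k + β (k + 1)) - (β (k + 1) + β (k + 1 + 1)) := by
  rw [← H.mul_eq_sub]
  exact mul_le_mul_of_nonneg_right (by exact_mod_cast hj) (H.pos _).le

theorem shift (H : IsEuclidean A β) (n : ℕ) :
    IsEuclidean (fun k => A (k + n)) (fun k => β (k + n)) where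
  one_le k := H.one_le _
  pos k := H.pos _
  eq k := by
    have := H.eq (k + n)
    rwa [add_right_comm k n 1, add_right_comm k n 2] at this

theorem exists_expansion (H : IsEuclidean A β) {x : ℝ} (hx : x ∈ Set.Icc 0 (β 0 + β 1)) :
    ∃ d : ℕ → ℕ, (∀ k, d k ≤ A k) ∧ HasSum (fun k => (d k : ℝ) * β (k + 1)) x := by
  refine exists_hasSum_of_le_tail (T := fun k => β k + β (k + 1)) (fun k => H.pos _) ?_ ?_ ?_ hx
  · simpa using H.tendsto_zero.add ((tendsto_add_atTop_iff_nat 1).2 H.tendsto_zero)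
  · intro k
    linarith [H.mul_eq_sub k]
  · intro k
    linarith [H.pos (k + 1 + 1)]

theorem hasSum_max (H : IsEuclidean A β) :
    HasSum (fun k => (A k : ℝ) * β (k + 1)) (β 0 + β 1) := by
  rw [hasSum_iff_tendsto_nat_of_nonneg fun k => mul_nonneg (Nat.cast_nonneg _) (H.pos _).le]
  have h1 : ∀ n, ∑ k ∈ range n, (A k : ℝ) * β (k + 1) = β 0 + β 1 - (β n + β (n + 1)) := by
    intro n
    rw [sum_congr rfl fun k _ => H.mul_eq_sub k]
    exact sum_range_sub' (fun k => β k + β (k + 1)) n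
  simp only [h1]
  simpa using (H.tendsto_zero.add ((tendsto_add_atTop_iff_nat 1).2 H.tendsto_zero)).const_sub
    (β 0 + β 1)

/-- In a unique expansion, no other digit can be continued to an expansion. -/
theorem digit_eq_of_unique (H : IsEuclidean A β) {x : ℝ} {d : ℕ → ℕ} (hd : ∀ k, d k ≤ A k)
    (hu : ∀ e : ℕ → ℕ, (∀ k, e k ≤ A k) → HasSum (fun k => (e k : ℝ) * β (k + 1)) x → e = d)
    {n j : ℕ} (hj : j ≤ A n)
    (hr : x - ∑ k ∈ range n, (d k : ℝ) * β (k + 1) - j * β (n + 1) ∈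
      Set.Icc 0 (β (n + 1) + β (n + 2))) : d n = j := by
  obtain ⟨t, ht, hts⟩ := (H.shift (n + 1)).exists_expansion
    (x := x - ∑ k ∈ range n, (d k : ℝ) * β (k + 1) - j * β (n + 1))
    (by simpa [add_comm, add_left_comm] using hr)
  -- Splice: keep the prefix of `d`, put `j` at place `n`, and continue with an expansion of the
  -- remainder.
  let e : ℕ → ℕ := fun k => if k < n then d k else if k = n then j else t (k - (n + 1))
  have he : ∀ k, e k ≤ A k := by
    intro k
    simp only [e]
    split_ifs with h1 h2
    · exact hd k
    · exact h2 ▸ hj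
    · have := ht (k - (n + 1))
      rwa [Nat.sub_add_cancel (by omega)] at this
  have hes : HasSum (fun k => (e k : ℝ) * β (k + 1)) x := by
    rw [← hasSum_nat_add_iff' (n + 1), sum_range_succ]
    have h1 : ∑ k ∈ range n, (e k : ℝ) * β (k + 1) = ∑ k ∈ range n, (d k : ℝ) * β (k + 1) :=
      sum_congr rfl fun k hk => by simp [e, mem_range.1 hk]
    have h2 : e n = j := by simp [e]
    rw [h1, h2, ← sub_sub]
    refine (congrArg (HasSum · _) (funext fun k => ?_)).mp hts
    have h3 : ¬ (k + (n + 1) < n) := by omega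
    have h4 : k + (n + 1) ≠ n := by omega
    simp only [e, h3, h4, if_false, Nat.add_sub_cancel, add_right_comm k 1 (n + 1)]
  have := congrFun (hu e he hes) n
  simpa [e] using this.symm

/-- If a bound failed, replacing `d n` by `d n - 1` or `d n + 1` would leave a remainder in the
attainable range, against uniqueness. -/
theorem tail_bounds_of_unique (H : IsEuclidean A β) {x : ℝ} {d : ℕ → ℕ} (hd : ∀ k, d k ≤ A k)
    (hx : HasSum (fun k => (d k : ℝ) * β (k + 1)) x)
    (hu : ∀ e : ℕ → ℕ, (∀ k, e k ≤ A k) → HasSum (fun k => (e k : ℝ) * β (k + 1)) x → e = d)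
    (n : ℕ) :
    (0 < d n → β (n + 2) < x - ∑ k ∈ range (n + 1), (d k : ℝ) * β (k + 1)) ∧
      (d n < A n → x - ∑ k ∈ range (n + 1), (d k : ℝ) * β (k + 1) < β (n + 1)) := by
  have h0 := hx.tail_nonneg (fun k => mul_nonneg (Nat.cast_nonneg _) (H.pos _).le) (n + 1)
  have h1 := hx.tail_le_of_le_sub (T := fun k => β k + β (k + 1))
    (fun k => (add_pos (H.pos _) (H.pos _)).le) (fun k => H.mul_le_sub (hd k)) (n + 1)
  simp only [show n + 1 + 1 = n + 2 by ring] at h1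
  have hp := H.pos (n + 1)
  have hp2 := H.pos (n + 2)
  refine ⟨fun h => ?_, fun h => ?_⟩
  · by_contra hc
    have := H.digit_eq_of_unique hd hu (n := n) (j := d n - 1) (by have := hd n; omega) (by
      rw [Nat.cast_sub h]
      rw [sum_range_succ] at *
      push_cast
      constructor <;> linarith)
    omega
  · by_contra hc
    have := H.digit_eq_of_unique hd hu (n := n) (j := d n + 1) h (by
      rw [sum_range_succ] at *
      push_cast
      constructor <;> linarith)
    omega

/-- A zero following a positive digit leaves the tail unchanged, yet it would have to be both above
and below `β (n + 2)`. A maximal digit following a nonmaximal one is excluded dually, through the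
recurrence at `n + 1`. -/
theorem digit_succ_of_unique (H : IsEuclidean A β) {x : ℝ} {d : ℕ → ℕ} (hd : ∀ k, d k ≤ A k)
    (hx : HasSum (fun k => (d k : ℝ) * β (k + 1)) x)
    (hu : ∀ e : ℕ → ℕ, (∀ k, e k ≤ A k) → HasSum (fun k => (e k : ℝ) * β (k + 1)) x → e = d)
    (n : ℕ) : (0 < d n → 0 < d (n + 1)) ∧ (d n < A n → d (n + 1) < A (n + 1)) := by
  have h0 := H.tail_bounds_of_unique hd hx hu n
  have h1 := H.tail_bounds_of_unique hd hx hu (n + 1)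
  rw [sum_range_succ _ (n + 1)] at h1
  simp only [show n + 1 + 1 = n + 2 by ring, show n + 1 + 2 = n + 3 by ring] at h1
  have hA := H.one_le (n + 1)
  have heq := H.eq (n + 1)
  simp only [show n + 1 + 1 = n + 2 by ring, show n + 1 + 2 = n + 3 by ring] at heq
  refine ⟨fun h => ?_, fun h => ?_⟩
  · by_contra hc
    have hz : d (n + 1) = 0 := by omega
    have h2 := h0.1 h
    have h3 := h1.2 (by omega)
    rw [hz] at h3
    simp only [Nat.cast_zero, zero_mul, add_zero] at h3
    linarith
  · by_contra hc
    have hz : d (n + 1) = A (n + 1) := by have := hd (n + 1); omega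
    have h2 := h0.2 h
    have h3 := h1.1 (by omega)
    rw [hz] at h3
    linarith

theorem eventually_digit_of_unique (H : IsEuclidean A β) {x : ℝ} (hx0 : 0 < x)
    (hx1 : x < β 0 + β 1) {d : ℕ → ℕ} (hd : ∀ k, d k ≤ A k)
    (hx : HasSum (fun k => (d k : ℝ) * β (k + 1)) x)
    (hu : ∀ e : ℕ → ℕ, (∀ k, e k ≤ A k) → HasSum (fun k => (e k : ℝ) * β (k + 1)) x → e = d) :
    ∃ N, ∀ k, N ≤ k → 0 < d k ∧ d k < A k := by
  have hstep := H.digit_succ_of_unique hd hx hu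
  obtain ⟨i, hi⟩ : ∃ i, 0 < d i := by
    by_contra! hc
    have : ∀ k, d k = 0 := fun k => Nat.le_zero.1 (hc k)
    simp only [this, Nat.cast_zero, zero_mul] at hx
    exact hx0.ne (hasSum_zero.unique hx)
  obtain ⟨j, hj⟩ : ∃ j, d j < A j := by
    by_contra! hc
    have : ∀ k, d k = A k := fun k => le_antisymm (hd k) (hc k)
    simp only [this] at hx
    exact hx1.ne (hx.unique H.hasSum_max)
  refine ⟨max i j, fun k hk => ⟨?_, ?_⟩⟩
  · exact Nat.le_induction hi (fun k _ h => (hstep k).1 h) k ((le_max_left _ _).trans hk)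
  · exact Nat.le_induction hj (fun k _ h => (hstep k).2 h) k ((le_max_right _ _).trans hk)

theorem tail_lt_of_lt (H : IsEuclidean A β) {x : ℝ} {d : ℕ → ℕ} (hd : ∀ k, d k < A k)
    (hx : HasSum (fun k => (d k : ℝ) * β (k + 1)) x) (n : ℕ) :
    x - ∑ k ∈ range n, (d k : ℝ) * β (k + 1) < β n := by
  have hle : ∀ k, (d k : ℝ) * β (k + 1) ≤ β k - β (k + 1) - β (k + 2) := by
    intro k
    have : (d k : ℝ) + 1 ≤ A k := by exact_mod_cast hd k
    nlinarith [H.eq k, H.pos (k + 1)]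
  have h1 := hx.tail_le_of_le_sub (fun k => (H.pos k).le)
    (fun k => by linarith [hle k, H.pos (k + 2)]) (n + 1)
  rw [sum_range_succ] at h1
  linarith [hle n, H.pos (n + 2)]

theorem lt_tail_of_pos (H : IsEuclidean A β) {x : ℝ} {d : ℕ → ℕ} {N : ℕ}
    (hd : ∀ k, N ≤ k → 0 < d k) (hx : HasSum (fun k => (d k : ℝ) * β (k + 1)) x) {n : ℕ}
    (hn : N ≤ n) : β (n + 1) < x - ∑ k ∈ range n, (d k : ℝ) * β (k + 1) := by
  have h1 := hx.tail_nonneg (fun k => mul_nonneg (Nat.cast_nonneg _) (H.pos _).le) (n + 2)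
  rw [sum_range_succ, sum_range_succ] at h1
  have h2 : (1 : ℝ) ≤ d n := by exact_mod_cast hd n hn
  have h3 : (1 : ℝ) ≤ d (n + 1) := by exact_mod_cast hd (n + 1) (by omega)
  nlinarith [H.pos (n + 1), H.pos (n + 1 + 1)]

/-- At the first disagreement, a smaller digit of `e` needs a tail larger than the maximal one,
because the tail of `d` exceeds `β (n + 2)`. A larger digit needs a negative tail, because the tail
of `d` is below `β (n + 1)`. Before `N` only the second case can occur. -/
theorem unique_of_digit (H : IsEuclidean A β) {x : ℝ} {d : ℕ → ℕ} {N : ℕ} (hd : ∀ k, d k < A k)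
    (hd0 : ∀ k, k < N → d k = 0) (hdN : ∀ k, N ≤ k → 0 < d k)
    (hx : HasSum (fun k => (d k : ℝ) * β (k + 1)) x) {e : ℕ → ℕ} (he : ∀ k, e k ≤ A k)
    (hex : HasSum (fun k => (e k : ℝ) * β (k + 1)) x) : e = d := by
  classical
  by_contra hne
  have hex' : ∃ n, e n ≠ d n := Function.ne_iff.1 hne
  have h1 := Nat.find_spec hex'
  have h2 : ∀ k < Nat.find hex', e k = d k := fun k hk => not_not.1 (Nat.find_min hex' hk)
  set n := Nat.find hex'
  have hsum : ∑ k ∈ range n, (e k : ℝ) * β (k + 1) = ∑ k ∈ range n, (d k : ℝ) * β (k + 1) :=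
    sum_congr rfl fun k hk => by rw [h2 k (mem_range.1 hk)]
  have hp := H.pos (n + 1)
  rcases lt_or_gt_of_ne h1 with h | h
  · have hnN : N ≤ n := by
      by_contra hc
      have := hd0 n (by omega)
      omega
    have h3 := hex.tail_le_of_le_sub (T := fun k => β k + β (k + 1))
      (fun k => (add_pos (H.pos _) (H.pos _)).le) (fun k => H.mul_le_sub (he k)) (n + 1)
    have h4 := H.lt_tail_of_pos hdN hx (n := n + 1) (by omega)
    rw [sum_range_succ] at h3 h4
    have h5 : (e n : ℝ) + 1 ≤ d n := by exact_mod_cast h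
    nlinarith
  · have h3 := hex.tail_nonneg (fun k => mul_nonneg (Nat.cast_nonneg _) (H.pos _).le) (n + 1)
    have h4 := H.tail_lt_of_lt hd hx (n + 1)
    rw [sum_range_succ] at h3 h4
    have h5 : (d n : ℝ) + 1 ≤ e n := by exact_mod_cast h
    nlinarith

end IsEuclidean

/-! ### Dimension of the unique set in terms of digit counts -/

theorem mem_uniqueSet_iff {α : ℝ} (h : Irrational α) (hα : α ∈ Set.Ioo (0 : ℝ) 1) {x : ℝ} :
    x ∈ uniqueSet α ↔ x ∈ Set.Ioo (0 : ℝ) 1 ∧ ∃! d : ℕ → ℕ,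
      (∀ k, d k ≤ partialQuotient α (k + 1)) ∧
        HasSum (fun k => (d k : ℝ) * gaussProd α (k + 1)) x := by
  simp only [uniqueSet, digitSpace, IsExpansion, rotBase_succ h hα, Set.mem_ofPred_eq]

theorem ne_one_of_lastOne_lt {α : ℝ} (hfin : (onesIndices α).Finite) {n : ℕ}
    (hn : lastOne α < n) : partialQuotient α n ≠ 1 := fun h =>
  hn.not_ge (le_csSup hfin.bddAbove ⟨by omega, h⟩)

theorem two_le_partialQuotient {α : ℝ} (h : Irrational α) (hfin : (onesIndices α).Finite) {k : ℕ}
    (hk : lastOne α ≤ k) : 2 ≤ partialQuotient α (k + 1) := by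
  have h1 := one_le_partialQuotient h k
  have h2 := ne_one_of_lastOne_lt hfin (Nat.lt_succ_of_le hk)
  simp only [Nat.succ_eq_add_one] at h2
  omega

/-- The number of digits used after the last partial quotient equal to `1`. -/
noncomputable def digitCount (α : ℝ) (k : ℕ) : ℕ :=
  if k < lastOne α then 1 else partialQuotient α (k + 1) - 1

theorem one_le_digitCount {α : ℝ} (h : Irrational α) (hfin : (onesIndices α).Finite) (k : ℕ) :
    1 ≤ digitCount α k := by
  rw [digitCount]
  split_ifs with hk
  · exact le_rfl
  · have := two_le_partialQuotient h hfin (not_lt.1 hk)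
    omega

theorem log_prod_digitCount {α : ℝ} (h : Irrational α) (hfin : (onesIndices α).Finite) (n : ℕ) :
    Real.log (∏ k ∈ range n, (digitCount α k : ℝ)) =
      ∑ k ∈ Icc (lastOne α + 1) n, Real.log ((partialQuotient α k : ℝ) - 1) := by
  rw [Real.log_prod fun k _ => 
    Nat.cast_ne_zero.2 (Nat.pos_iff_ne_zero.1 (one_le_digitCount h hfin k))]
  induction n with
  | zero => simp
  | succ n ih =>
    rw [sum_range_succ, ih]
    rcases lt_or_ge n (lastOne α) with hn | hn
    · rw [Icc_eq_empty (by omega), Icc_eq_empty (by omega)]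
      simp [digitCount, hn]
    · rw [← insert_Icc_right_eq_Icc_add_one (by omega), sum_insert (by simp), add_comm]
      congr 2
      rw [digitCount, if_neg (by omega), Nat.cast_sub (one_le_partialQuotient h n), Nat.cast_one]

theorem uniqueSet_subset {α : ℝ} (h : Irrational α) (hα : α ∈ Set.Ioo (0 : ℝ) 1) :
    uniqueSet α ⊆ ⋃ N : ℕ, {x : ℝ | ∃ d : ℕ → ℕ,
      (∀ k, d k ∈ if k < max N (lastOne α) then Iic (partialQuotient α (k + 1))
        else Ico 1 (partialQuotient α (k + 1))) ∧
      HasSum (fun k => (d k : ℝ) * gaussProd α (k + 1)) x} := by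
  intro x hx
  obtain ⟨hx01, d, ⟨hd, hdx⟩, hu⟩ := (mem_uniqueSet_iff h hα).1 hx
  have H := isEuclidean_gaussProd h
  obtain ⟨N, hN⟩ := H.eventually_digit_of_unique hx01.1
    (by rw [gaussProd_zero]; linarith [hx01.2, H.pos 1]) hd hdx fun e h1 h2 => hu e ⟨h1, h2⟩
  refine Set.mem_iUnion.2 ⟨N, d, fun k => ?_, hdx⟩
  split_ifs with hk
  · exact mem_Iic.2 (hd k)
  · exact mem_Ico.2 (hN k ((le_max_left _ _).trans (not_lt.1 hk)))

theorem dimH_uniqueSet_eq_zero {α : ℝ} (h : Irrational α) (hα : α ∈ Set.Ioo (0 : ℝ) 1)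
    (hfin : (onesIndices α).Finite)
    (hfreq : ∀ s : ℝ, 0 < s → ∃ᶠ n in atTop,
      (∏ k ∈ range n, (digitCount α k : ℝ)) ≤ gaussProd α n ^ (-s)) :
    dimH (uniqueSet α) = 0 := by
  have H := isEuclidean_gaussProd h
  refine le_antisymm (ENNReal.le_of_forall_pos_le_add fun s hs _ => ?_) bot_le
  rw [zero_add]
  refine (dimH_mono (uniqueSet_subset h hα)).trans ?_
  -- Countable stability of dimension allows the index `N` at which the digits become interior to be
  -- fixed.
  rw [dimH_iUnion]
  refine iSup_le fun N => ?_
  set m := max N (lastOne α)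
  have hT2 : ∀ k, gaussProd α k + gaussProd α (k + 1) ≤ 2 * gaussProd α k := fun k => by
    linarith [H.succ_lt k]
  have key := dimH_le_of_frequently_card_le (w := fun k => gaussProd α (k + 1))
    (T := fun k => gaussProd α k + gaussProd α (k + 1))
    (D := fun k => if k < m then Iic (partialQuotient α (k + 1))
        else Ico 1 (partialQuotient α (k + 1))) (s := s)
    -- The product counts the unrestricted prefixes; `2 ^ s` comes from `T n ≤ 2 * gaussProd α n`.
    (K := (∏ k ∈ range m, (partialQuotient α (k + 1) + 1 : ℝ)) * 2 ^ (s : ℝ))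
    (fun k => (H.pos _).le) (fun k => add_pos (H.pos _) (H.pos _))
    (by simpa using H.tendsto_zero.add ((tendsto_add_atTop_iff_nat 1).2 H.tendsto_zero))
    (fun k j hj => by
      refine H.mul_le_sub ?_
      split_ifs at hj
      · exact mem_Iic.1 hj
      · exact (mem_Ico.1 hj).2.le) s.2 ?_
  · simpa using key
  · refine ((hfreq s hs).and_eventually (eventually_ge_atTop m)).mono fun n ⟨hn, hmn⟩ => ?_
    have hle : (gaussProd α n) ^ (-(s : ℝ)) ≤
        2 ^ (s : ℝ) * (gaussProd α n + gaussProd α (n + 1)) ^ (-(s : ℝ)) := by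
      have h1 := Real.rpow_le_rpow_of_nonpos (add_pos (H.pos n) (H.pos (n + 1))) (hT2 n)
        (neg_nonpos.2 s.2)
      rw [Real.mul_rpow (by norm_num) (H.pos n).le, Real.rpow_neg (by norm_num)] at h1
      rwa [inv_mul_le_iff₀ (by positivity)] at h1
    have hprod : (∏ k ∈ range n, ((if k < m then Iic (partialQuotient α (k + 1))
        else Ico 1 (partialQuotient α (k + 1))).card : ℝ)) ≤
        (∏ k ∈ range m, (partialQuotient α (k + 1) + 1 : ℝ)) *
          ∏ k ∈ range n, (digitCount α k : ℝ) := by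
      rw [← prod_range_mul_prod_Ico _ hmn, ← prod_range_mul_prod_Ico (fun k => (digitCount α k : ℝ)) hmn]
      have e1 : (∏ k ∈ range m, ((if k < m then Iic (partialQuotient α (k + 1))
          else Ico 1 (partialQuotient α (k + 1))).card : ℝ)) =
          ∏ k ∈ range m, (partialQuotient α (k + 1) + 1 : ℝ) :=
        prod_congr rfl fun k hk => by simp [mem_range.1 hk]
      have e2 : (∏ k ∈ Ico m n, ((if k < m then Iic (partialQuotient α (k + 1))
          else Ico 1 (partialQuotient α (k + 1))).card : ℝ)) =
          ∏ k ∈ Ico m n, (digitCount α k : ℝ) :=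
        prod_congr rfl fun k hk => by
          have h1 := (mem_Ico.1 hk).1
          have h2 : ¬ k < lastOne α := not_lt.2 ((le_max_right _ _).trans h1)
          simp [digitCount, not_lt.2 h1, h2]
      rw [e1, e2]
      refine mul_le_mul_of_nonneg_left ?_ (prod_nonneg fun k _ => by positivity)
      refine le_mul_of_one_le_left (prod_nonneg fun k _ => by positivity) ?_
      exact one_le_prod fun k _ => by exact_mod_cast one_le_digitCount h hfin k
    refine hprod.trans ?_
    rw [mul_assoc]
    exact mul_le_mul_of_nonneg_left (hn.trans hle) (prod_nonneg fun k _ => by positivity)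

theorem dimH_uniqueSet_pos {α : ℝ} (h : Irrational α) (hα : α ∈ Set.Ioo (0 : ℝ) 1)
    (hfin : (onesIndices α).Finite) {c s : ℝ} (hc : 0 < c) (hs : 0 < s) (hs1 : s ≤ 1)
    (hM : ∀ n, c * gaussProd α n ^ (-s) ≤ ∏ k ∈ range n, (digitCount α k : ℝ)) :
    0 < dimH (uniqueSet α) := by
  have H := isEuclidean_gaussProd h
  have hA1 : ∀ k, (1 : ℝ) ≤ partialQuotient α (k + 1) := fun k => by
    exact_mod_cast one_le_partialQuotient h k
  have hcount : ∀ k, lastOne α ≤ k →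
      (digitCount α k : ℝ) = partialQuotient α (k + 1) - 1 := by
    intro k hk
    rw [digitCount, if_neg (not_lt.2 hk), Nat.cast_sub (one_le_partialQuotient h k), Nat.cast_one]
  have hmβ : ∀ k, (digitCount α k : ℝ) * gaussProd α (k + 1) ≤ gaussProd α k := by
    intro k
    rcases lt_or_ge k (lastOne α) with hk | hk
    · rw [digitCount, if_pos hk]
      simpa using (H.succ_lt k).le
    · rw [hcount k hk]
      nlinarith [H.eq k, H.pos (k + 1), H.pos (k + 2)]
  have hS0 : 0 ≤ ∑ k ∈ range (lastOne α), (partialQuotient α (k + 1) : ℝ) :=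
    sum_nonneg fun _ _ => Nat.cast_nonneg _
  -- Always `β k ≤ (A k + 1) * β (k + 1)`. From `n_0` on, `A k ≥ 2` gives `A k + 1 ≤ 3 * (A k - 1)`;
  -- the sum covers the finitely many earlier indices.
  have hKβ : ∀ k, gaussProd α k ≤ (3 + ∑ k ∈ range (lastOne α), (partialQuotient α (k + 1) : ℝ)) *
      (digitCount α k * gaussProd α (k + 1)) := by
    intro k
    have h1 := H.eq k
    have h2 := H.succ_lt (k + 1)
    have hp := H.pos (k + 1)
    rcases lt_or_ge k (lastOne α) with hk | hk
    · rw [digitCount, if_pos hk]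
      have h3 := single_le_sum (f := fun k => (partialQuotient α (k + 1) : ℝ))
        (fun _ _ => Nat.cast_nonneg _) (mem_range.2 hk)
      push_cast
      nlinarith
    · rw [hcount k hk]
      have h3 : (2 : ℝ) ≤ partialQuotient α (k + 1) := by
        exact_mod_cast two_le_partialQuotient h hfin hk
      have h4 : 0 ≤ ((partialQuotient α (k + 1) : ℝ) - 1) * gaussProd α (k + 1) :=
        mul_nonneg (by linarith) hp.le
      nlinarith
  have key := dimH_digits_pos H.pos (one_le_digitCount h hfin) hmβ H.tendsto_zero
    (by positivity) hKβ hc hs hs1 hM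
  -- Adding `l` moves the digits `0, …, A k - 2` to `1, …, A k - 1` from `n_0` on. On points this is
  -- the translation by `τ`, which preserves dimension.
  let l : ℕ → ℕ := fun k => if k < lastOne α then 0 else 1
  have hl : Summable fun k => (l k : ℝ) * gaussProd α (k + 1) := by
    refine Summable.of_nonneg_of_le (fun k => mul_nonneg (Nat.cast_nonneg _) (H.pos _).le)
      (fun k => ?_) H.hasSum_max.summable
    refine mul_le_mul_of_nonneg_right ((?_ : (l k : ℝ) ≤ 1).trans (hA1 k)) (H.pos _).le
    simp only [l]
    split_ifs <;> simp
  obtain ⟨τ, hτ⟩ := hl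
  rw [← (IsometryEquiv.addLeft τ).isometry.dimH_image] at key
  refine key.trans_le (dimH_mono ?_)
  rintro _ ⟨y, ⟨d, hd, hy⟩, rfl⟩
  have hx : HasSum (fun k => ((l k + d k : ℕ) : ℝ) * gaussProd α (k + 1)) (τ + y) := by
    simpa [add_mul] using hτ.add hy
  have hlt : ∀ k, l k + d k < partialQuotient α (k + 1) := by
    intro k
    have h1 := hd k
    have h2 := one_le_partialQuotient h k
    simp only [digitCount, l] at *
    split_ifs at * <;> omega
  have hzero : ∀ k, k < lastOne α → l k + d k = 0 := by
    intro k hk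
    have h1 := hd k
    simp only [digitCount, l, hk, if_true] at *
    omega
  have hpos : ∀ k, lastOne α ≤ k → 0 < l k + d k := by
    intro k hk
    simp only [l, not_lt.2 hk, if_false]
    omega
  change τ + y ∈ _
  refine (mem_uniqueSet_iff h hα).2 ⟨⟨?_, ?_⟩, fun k => l k + d k, ⟨fun k => (hlt k).le, hx⟩,
    fun e he => H.unique_of_digit hlt hzero hpos hx he.1 he.2⟩
  · have h1 := H.lt_tail_of_pos hpos hx le_rfl
    have h2 : 0 ≤ ∑ k ∈ range (lastOne α), ((l k + d k : ℕ) : ℝ) * gaussProd α (k + 1) :=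
      sum_nonneg fun k _ => mul_nonneg (Nat.cast_nonneg _) (H.pos _).le
    linarith [H.pos (lastOne α + 1)]
  · have h1 := H.tail_lt_of_lt hlt hx 0
    simpa [gaussProd_zero] using h1

/-! ### From digit counts to the logarithmic ratio -/

theorem eventually_one_lt_convDen {α : ℝ} (h : Irrational α) :
    ∀ᶠ n in atTop, 1 < convDen α (n + 1) := by
  have H := isEuclidean_gaussProd h
  filter_upwards [H.tendsto_zero.eventually (gt_mem_nhds (by norm_num : (0 : ℝ) < 1 / 2))] with n hn
  by_contra! hc
  have h1 := one_le_two_mul_convDen_mul_gaussProd h n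
  nlinarith [H.pos n, convDen_pos h n]

theorem prod_digitCount_pos {α : ℝ} (h : Irrational α) (hfin : (onesIndices α).Finite) (n : ℕ) :
    0 < ∏ k ∈ range n, (digitCount α k : ℝ) :=
  prod_pos fun k _ => by exact_mod_cast one_le_digitCount h hfin k

theorem prod_digitCount_le_of_log_div_le {α : ℝ} (h : Irrational α)
    (hfin : (onesIndices α).Finite) {n : ℕ} (hn : 1 < convDen α (n + 1)) {s : ℝ} (hs : 0 ≤ s)
    (hle : (∑ k ∈ Icc (lastOne α + 1) n, Real.log ((partialQuotient α k : ℝ) - 1)) /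
      Real.log (convDen α (n + 1)) ≤ s) :
    (∏ k ∈ range n, (digitCount α k : ℝ)) ≤ gaussProd α n ^ (-s) := by
  have H := isEuclidean_gaussProd h
  rw [div_le_iff₀ (Real.log_pos hn), ← log_prod_digitCount h hfin,
    ← Real.log_rpow (convDen_pos h n),
    Real.log_le_log_iff (prod_digitCount_pos h hfin n) (Real.rpow_pos_of_pos (convDen_pos h n) s)]
    at hle
  refine hle.trans ?_
  rw [Real.rpow_neg (H.pos n).le, ← Real.inv_rpow (H.pos n).le]
  refine Real.rpow_le_rpow (convDen_pos h n).le ?_ hs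
  rw [← one_div, le_div_iff₀ (H.pos n)]
  exact convDen_mul_gaussProd_le h n

theorem le_prod_digitCount_of_le_log_div {α : ℝ} (h : Irrational α)
    (hfin : (onesIndices α).Finite) {n : ℕ} (hn : 1 < convDen α (n + 1)) {s : ℝ} (hs : 0 ≤ s)
    (hle : s ≤ (∑ k ∈ Icc (lastOne α + 1) n, Real.log ((partialQuotient α k : ℝ) - 1)) /
      Real.log (convDen α (n + 1))) :
    2 ^ (-s) * gaussProd α n ^ (-s) ≤ ∏ k ∈ range n, (digitCount α k : ℝ) := by
  have H := isEuclidean_gaussProd h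
  rw [le_div_iff₀ (Real.log_pos hn), ← log_prod_digitCount h hfin,
    ← Real.log_rpow (convDen_pos h n),
    Real.log_le_log_iff (Real.rpow_pos_of_pos (convDen_pos h n) s) (prod_digitCount_pos h hfin n)]
    at hle
  refine le_trans ?_ hle
  rw [← Real.mul_rpow (by norm_num) (H.pos n).le, Real.rpow_neg (by linarith [H.pos n]),
    ← Real.inv_rpow (by linarith [H.pos n])]
  refine Real.rpow_le_rpow (inv_nonneg.2 (by linarith [H.pos n])) ?_ hs
  rw [← one_div, div_le_iff₀ (by linarith [H.pos n])]
  linarith [one_le_two_mul_convDen_mul_gaussProd h n]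

theorem exists_forall_le_prod_digitCount {α : ℝ} (h : Irrational α)
    (hfin : (onesIndices α).Finite) {c s : ℝ} (hc : 0 < c) (hs : 0 ≤ s)
    (hev : ∀ᶠ n in atTop,
      c * gaussProd α n ^ (-s) ≤ ∏ k ∈ range n, (digitCount α k : ℝ)) :
    ∃ c' > 0, ∀ n, c' * gaussProd α n ^ (-s) ≤ ∏ k ∈ range n, (digitCount α k : ℝ) := by
  have H := isEuclidean_gaussProd h
  obtain ⟨N, hN⟩ := eventually_atTop.1 hev
  have hpos : ∀ n, 0 < gaussProd α n ^ (-s) := fun n => Real.rpow_pos_of_pos (H.pos n) _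
  -- For `n ≤ N` the second entry makes the left side at most `1`, which no product of digit counts
  -- falls below.
  refine ⟨min c (gaussProd α N ^ (-s))⁻¹, lt_min hc (inv_pos.2 (hpos N)), fun n => ?_⟩
  rcases le_total N n with hn | hn
  · exact (mul_le_mul_of_nonneg_right (min_le_left _ _) (hpos n).le).trans (hN n hn)
  · refine (mul_le_mul_of_nonneg_right (min_le_right _ _) (hpos n).le).trans ?_
    refine le_trans ?_ (one_le_prod fun k _ => by exact_mod_cast one_le_digitCount h hfin k)
    rw [inv_mul_le_iff₀ (hpos N), mul_one]
    exact Real.rpow_le_rpow_of_nonpos (H.pos N) (H.strictAnti.antitone hn) (neg_nonpos.2 hs)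

end RotationalExpansion

open RotationalExpansion in
theorem mainTheorem3 (α : ℝ) (hirr : Irrational α) (hα : α ∈ Set.Ioo (0 : ℝ) 1)
    (hfin : (RotationalExpansion.onesIndices α).Finite) :
    0 < dimH (RotationalExpansion.uniqueSet α) ↔
      0 < Filter.liminf
        (fun n : ℕ =>
          (((∑ k ∈ Finset.Icc (RotationalExpansion.lastOne α + 1) n,
              Real.log ((RotationalExpansion.partialQuotient α k : ℝ) - 1)) /
            Real.log (RotationalExpansion.convDen α (n + 1)) : ℝ) : EReal))
        Filter.atTop := by
  constructor
  · intro hpos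
    by_contra hlim
    refine hpos.ne' (dimH_uniqueSet_eq_zero hirr hα hfin fun s hs => ?_)
    have hfreq : ∃ᶠ n : ℕ in atTop,
        (∑ k ∈ Finset.Icc (lastOne α + 1) n, Real.log ((partialQuotient α k : ℝ) - 1)) /
            Real.log (convDen α (n + 1)) < s := by
      by_contra hc
      rw [not_frequently] at hc
      refine hlim (lt_of_lt_of_le (EReal.coe_pos.2 hs) (le_liminf_of_le (by isBoundedDefault) ?_))
      filter_upwards [hc] with n hn
      exact EReal.coe_le_coe_iff.2 (not_lt.1 hn)
    exact (hfreq.and_eventually (eventually_one_lt_convDen hirr)).mono fun n hn =>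
      prod_digitCount_le_of_log_div_le hirr hfin hn.2 hs.le hn.1.le
  · intro hlim
    obtain ⟨s, hs0, hs⟩ := EReal.lt_iff_exists_real_btwn.1 hlim
    have hs0' : 0 < s := EReal.coe_pos.1 hs0
    -- The exponent is capped at `1` because the Hölder estimate requires it.
    have ht0 : 0 < min s 1 := lt_min hs0' one_pos
    obtain ⟨c, hc, hM⟩ := exists_forall_le_prod_digitCount hirr hfin
      (c := 2 ^ (-min s 1)) (s := min s 1) (by positivity) ht0.le (by
        filter_upwards [eventually_lt_of_lt_liminf hs, eventually_one_lt_convDen hirr] with n h1 h2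
        exact le_prod_digitCount_of_le_log_div hirr hfin h2 ht0.le
          ((min_le_left _ _).trans (EReal.coe_lt_coe_iff.1 h1).le))
    exact dimH_uniqueSet_pos hirr hα hfin hc ht0 (min_le_right _ _) hM
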